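/- Let $X$ be a complex Banach space and let $T$ be a bounded linear operator on $X$, with Banach space adjoint $T^*$ acting on the dual $X^*$. Then $$\sigma_{gD}(T)=\sigma_{gK}(T)\cup S(T)\cup S(T^*).$$ Here the following definitions are used. A bounded operator $A$ on a complex Banach space $Y$ is *quasinilpotent* if its spectral radius is $0$; it is *semi-regular* (Kato) if its range $R(A)$ is closed and its null space satisfies $N(A)\subseteq\bigcap_{n\ge 0}R(A^n)$; it is *pseudo-Fredholm* (admits a generalized Kato decomposition) if there are closed $A$-invariant subspaces $M,N$ of $Y$ with $Y=M\oplus N$ such that $A|_M$ is semi-regular and $A|_N$ is quasinilpotent; it is *generalized Drazin invertible* if there is a bounded operator $B$ on $Y$ with $AB=BA$, $B^2A=B$ and $A^2B-A$ quasinilpotent. The generalized Kato spectrum and the generalized Drazin spectrum of $T$ are $$\sigma_{gK}(T)=\{\lambda\in\mathbb C: T-\lambda I\text{ is not pseudo-Fredholm}\},\qquad \sigma_{gD}(T)=\{\lambda\in\mathbb C: T-\lambda I\text{ is not generalized Drazin invertible}\}.$$ The operator $A$ has the *single-valued extension property* (SVEP) at $\lambda_0\in\mathbb C$ if for every connected open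 neighbourhood $U$ of $\lambda_0$ the only analytic function $f:U\to Y$ with $(A-zI)f(z)=0$ for all $z\in U$ is $f\equiv 0$; and $S(A)$ denotes the set of all $\lambda\in\mathbb C$ at which $A$ does not have the SVEP. -/

import Mathlib

namespace GenKato

section Operators

variable {X : Type*} [NormedAddCommGroup X] [NormedSpace ℂ X]

/-- The shifted operator `T - z I`. -/
def shift (T : X →L[ℂ] X) (z : ℂ) : X →L[ℂ] X :=
  T - z • ContinuousLinearMap.id ℂ X

/-- The Banach space adjoint `T*`, acting on the topological dual by `φ ↦ φ ∘ T`. -/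
noncomputable def dualOp (T : X →L[ℂ] X) : StrongDual ℂ X →L[ℂ] StrongDual ℂ X :=
  ContinuousLinearMap.precomp ℂ T

/-- Kato (semi-regular) operators: the range is closed and the null space is contained in the
hyper-range `⋂ n, R(T ^ n)`. -/
def IsSemiRegular (T : X →L[ℂ] X) : Prop :=
  IsClosed (Set.range T) ∧ ∀ x : X, T x = 0 → ∀ n : ℕ, x ∈ Set.range (T ^ n)

/-- Quasinilpotent operators: the spectral radius is zero, that is, the spectrum contains no
nonzero point (the spectrum is empty when the space is zero). -/
def IsQuasinilpotent (T : X →L[ℂ] X) : Prop :=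
  spectralRadius ℂ T = 0

/-- Pseudo-Fredholm operators, i.e. operators admitting a generalized Kato decomposition:
`X = M ⊕ N` with `M`, `N` closed and `T`-invariant, `T` restricted to `M` semi-regular and
`T` restricted to `N` quasinilpotent. -/
def IsPseudoFredholm (T : X →L[ℂ] X) : Prop :=
  ∃ (M N : Submodule ℂ X) (hM : Set.MapsTo T M M) (hN : Set.MapsTo T N N),
    IsClosed (M : Set X) ∧ IsClosed (N : Set X) ∧ IsCompl M N ∧
    IsSemiRegular (T.restrict hM) ∧ IsQuasinilpotent (T.restrict hN)

/-- Generalized Drazin invertible operators in the sense of Koliha: there is a bounded `S`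
commuting with `T` such that `S² T = S` and `T² S - T` is quasinilpotent. -/
def IsGenDrazinInvertible (T : X →L[ℂ] X) : Prop :=
  ∃ S : X →L[ℂ] X, S * T = T * S ∧ S ^ 2 * T = S ∧ IsQuasinilpotent (T ^ 2 * S - T)

/-- The single-valued extension property at `z₀`: for every connected open neighbourhood `U` of
`z₀`, the only analytic `f : U → X` with `(T - z I) f(z) = 0` on `U` is `f = 0`. Connectedness
is needed: otherwise `f` could be nonzero on a component of `U` that does not contain `z₀`, and
the property would not be local at `z₀` (it could fail at points of the resolvent set). -/
def HasSVEPAt (T : X →L[ℂ] X) (z₀ : ℂ) : Prop :=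
  ∀ U : Set ℂ, IsOpen U → IsConnected U → z₀ ∈ U →
    ∀ f : ℂ → X, AnalyticOnNhd ℂ f U → (∀ z ∈ U, shift T z (f z) = 0) → ∀ z ∈ U, f z = 0

/-- The set `S(T)` of points at which `T` fails to have the SVEP. -/
def svepFailure (T : X →L[ℂ] X) : Set ℂ := {z | ¬ HasSVEPAt T z}

/-- The generalized Kato (pseudo-Fredholm) spectrum. -/
def genKatoSpectrum (T : X →L[ℂ] X) : Set ℂ := {z | ¬ IsPseudoFredholm (shift T z)}

/-- The generalized Drazin spectrum. -/
def genDrazinSpectrum (T : X →L[ℂ] X) : Set ℂ := {z | ¬ IsGenDrazinInvertible (shift T z)}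

end Operators

end GenKato

namespace GenKato

open Filter Topology

/-! ### Shifts, adjoints and quasinilpotence. -/

section Basic

variable {X : Type*} [NormedAddCommGroup X] [NormedSpace ℂ X]

/-! Put `A = T - z₀`. If `A` is generalized Drazin invertible, `T - z` is bijective for `z ≠ z₀`
near `z₀`, so it and its adjoint are injective there and the identity theorem gives both SVEPs; the
idempotent `AB` splits off the quasinilpotent part. Conversely, take a generalized Kato
decomposition `M ⊕ N`. Semi-regularity lets a kernel vector of `A|M` be pulled back along `A`
forever with geometric growth, and the orbit is the coefficient sequence of an analytic solution of
`(T - z) f(z) = 0`; SVEP of `T` makes it zero. The same argument for functionals annihilating the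
range of `A|M`, with SVEP of `T*`, gives surjectivity. So `A|M` is invertible, and its inverse
extended by zero on `N` is a generalized Drazin inverse. -/

theorem shift_apply (T : X →L[ℂ] X) (z : ℂ) (x : X) : shift T z x = T x - z • x := by
  simp [shift]

theorem shift_shift (T : X →L[ℂ] X) (a b : ℂ) : shift (shift T a) b = shift T (a + b) := by
  simp only [shift, add_smul]; abel

theorem coe_shift_restrict (T : X →L[ℂ] X) {M : Submodule ℂ X} (hM : Set.MapsTo T M M) (z : ℂ)
    (x : M) : (shift (T.restrict hM) z x : X) = T x - z • (x : X) := by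
  rw [shift_apply]; rfl

@[simp]
theorem dualOp_apply (T : X →L[ℂ] X) (φ : StrongDual ℂ X) : dualOp T φ = φ.comp T := rfl

theorem dualOp_shift (T : X →L[ℂ] X) (z : ℂ) : dualOp (shift T z) = shift (dualOp T) z := by
  ext φ x
  simp [shift_apply]

theorem isQuasinilpotent_iff [CompleteSpace X] {T : X →L[ℂ] X} :
    IsQuasinilpotent T ↔ ∀ z : ℂ, z ≠ 0 → Function.Bijective (shift T z) := by
  have key : ∀ z : ℂ, z ∈ spectrum ℂ T ↔ ¬ Function.Bijective (shift T z) := by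
    intro z
    rw [spectrum.mem_iff, ← ContinuousLinearMap.isUnit_iff_bijective, ← IsUnit.neg_iff, neg_sub,
      Algebra.algebraMap_eq_smul_one]
    rfl
  simp only [IsQuasinilpotent, spectralRadius, ENNReal.iSup_eq_zero, key, ENNReal.coe_eq_zero,
    nnnorm_eq_zero]
  exact forall_congr' fun z ↦ not_imp_comm

end Basic

/-! ### SVEP: power series solutions and the identity theorem. -/

section SVEP

variable {X : Type*} [NormedAddCommGroup X] [NormedSpace ℂ X] [CompleteSpace X]

/-- Backward orbits of geometric growth starting in the kernel are trivial under the SVEP. -/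
theorem HasSVEPAt.eq_zero_of_backward_orbit {T : X →L[ℂ] X} {z₀ : ℂ} (hT : HasSVEPAt T z₀)
    {x : ℕ → X} {C K : ℝ} (hC : 0 < C) (hx : ∀ n, ‖x n‖ ≤ K * C ^ n)
    (h0 : shift T z₀ (x 0) = 0) (hs : ∀ n, shift T z₀ (x (n + 1)) = x n) : x 0 = 0 := by
  -- On this radius the series `∑ (z - z₀)^n x_n` is dominated by `∑ K (1/2)^n`; the shift in the
  -- orbit makes it an eigenvector for `z`.
  set U : Set ℂ := Metric.ball z₀ (1 / (2 * C)) with hU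
  have hr : 0 < 1 / (2 * C) := by positivity
  have hz₀ : z₀ ∈ U := Metric.mem_ball_self hr
  have hbound : ∀ n, ∀ z ∈ U, ‖(z - z₀) ^ n • x n‖ ≤ K * (1 / 2) ^ n := by
    intro n z hz
    have hz' : ‖z - z₀‖ ≤ 1 / (2 * C) := (mem_ball_iff_norm.1 hz).le
    calc ‖(z - z₀) ^ n • x n‖ = ‖z - z₀‖ ^ n * ‖x n‖ := by rw [norm_smul, norm_pow]
      _ ≤ (1 / (2 * C)) ^ n * (K * C ^ n) := by
        gcongr
        exact hx n
      _ = K * (1 / 2) ^ n := by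
        rw [mul_left_comm, ← mul_pow]
        congr 2
        field_simp
  have hsum : Summable fun n : ℕ ↦ K * (1 / 2 : ℝ) ^ n :=
    summable_geometric_two.mul_left K
  have hsm : ∀ z ∈ U, Summable fun n ↦ (z - z₀) ^ n • x n := fun z hz ↦
    hsum.of_norm_bounded (hbound · z hz)
  have hf := hT U Metric.isOpen_ball
    ((convex_ball z₀ _).isConnected ⟨z₀, hz₀⟩) hz₀
    (fun z ↦ ∑' n, (z - z₀) ^ n • x n)
    (DifferentiableOn.analyticOnNhd (Complex.differentiableOn_tsum_of_summable_norm hsum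
      (fun n ↦ by fun_prop) Metric.isOpen_ball hbound) Metric.isOpen_ball)
    (fun z hz ↦ by
      have e : shift T z = shift T z₀ - (z - z₀) • ContinuousLinearMap.id ℂ X := by
        rw [← shift, shift_shift, add_sub_cancel]
      have h1 : shift T z₀ (∑' n, (z - z₀) ^ n • x n)
          = (z - z₀) • ∑' n, (z - z₀) ^ n • x n := by
        rw [(shift T z₀).map_tsum (hsm z hz), ((hsm z hz).mapL (shift T z₀)).tsum_eq_zero_add,
          ← tsum_const_smul'']
        simp [h0, hs, smul_smul, pow_succ']
      simp [e, h1]) z₀ hz₀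
  have : ∑' n, (z₀ - z₀) ^ n • x n = x 0 := by
    rw [tsum_eq_single 0 (fun n hn ↦ by simp [hn])]
    simp
  rwa [this] at hf

omit [CompleteSpace X] in
theorem hasSVEPAt_of_frequently_injective {T : X →L[ℂ] X} {z₀ : ℂ}
    (h : ∃ᶠ z in 𝓝[≠] z₀, Function.Injective (shift T z)) : HasSVEPAt T z₀ := by
  intro U hU hc hz₀ f hf hfz
  refine hf.eqOn_zero_of_preconnected_of_frequently_eq_zero hc.isPreconnected hz₀ ?_
  have hUn : ∀ᶠ z in 𝓝[≠] z₀, z ∈ U := mem_nhdsWithin_of_mem_nhds (hU.mem_nhds hz₀)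
  exact (h.and_eventually hUn).mono fun z hz ↦ hz.1 (by simpa using hfz z hz.2)

end SVEP

/-! ### Backward orbits of semi-regular operators and their adjoints. -/

section SemiRegular

variable {X : Type*} [NormedAddCommGroup X] [NormedSpace ℂ X] [CompleteSpace X]

theorem exists_preimage_norm_le_of_isClosed_range {T : X →L[ℂ] X} (h : IsClosed (Set.range T)) :
    ∃ C > 0, ∀ y ∈ Set.range T, ∃ x, T x = y ∧ ‖x‖ ≤ C * ‖y‖ := by
  have h' : IsClosed (T.range : Set X) := by rwa [LinearMap.coe_range]
  have := h'.completeSpace_coe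
  obtain ⟨C, hC, H⟩ := T.rangeRestrict.exists_preimage_norm_le
    (by rintro ⟨_, x, rfl⟩; exact ⟨x, rfl⟩)
  refine ⟨C, hC, fun y hy ↦ ?_⟩
  obtain ⟨x, hx, hn⟩ := H ⟨y, hy⟩
  exact ⟨x, congrArg Subtype.val hx, hn⟩

theorem IsSemiRegular.exists_backward_orbit {T : X →L[ℂ] X} (h : IsSemiRegular T) {x₀ : X}
    (hx₀ : T x₀ = 0) : ∃ (x : ℕ → X) (C : ℝ), 0 < C ∧ x 0 = x₀ ∧ (∀ n, T (x (n + 1)) = x n) ∧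
      ∀ n, ‖x n‖ ≤ ‖x₀‖ * C ^ n := by
  obtain ⟨C, hC, H⟩ := exists_preimage_norm_le_of_isClosed_range h.1
  have step : ∀ y : X, (∀ n : ℕ, y ∈ Set.range (T ^ n)) →
      ∃ x, (T x = y ∧ ‖x‖ ≤ C * ‖y‖) ∧ ∀ n : ℕ, x ∈ Set.range (T ^ n) := by
    intro y hy
    obtain ⟨x, hx, hn⟩ := H y (by simpa using hy 1)
    refine ⟨x, ⟨hx, hn⟩, fun n ↦ ?_⟩
    obtain ⟨u, hu⟩ := hy (n + 1)
    -- As `T x = y = T^(n+1) u`, the difference `x - T^n u` lies in the kernel, hence in the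
    -- hyper-range: any preimage of a hyper-range vector is again in it.
    obtain ⟨v, hv⟩ := h.2 (x - (T ^ n) u)
      (by rw [map_sub, hx, ← hu, pow_succ', mul_apply_eq_comp, sub_self]) n
    exact ⟨u + v, by rw [map_add, hv, add_sub_cancel]⟩
  choose! g hg hgr using step
  have hmem : ∀ n m : ℕ, g^[n] x₀ ∈ Set.range (T ^ m) := by
    intro n
    induction n with
    | zero => exact h.2 x₀ hx₀
    | succ n ih => rw [Function.iterate_succ_apply']; exact hgr _ ih
  refine ⟨fun n ↦ g^[n] x₀, C, hC, rfl, fun n ↦ ?_, fun n ↦ ?_⟩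
  · simp only [Function.iterate_succ_apply']
    exact (hg _ (hmem n)).1
  · induction n with
    | zero => simp
    | succ n ih =>
      simp only [Function.iterate_succ_apply']
      calc ‖g (g^[n] x₀)‖ ≤ C * ‖g^[n] x₀‖ := (hg _ (hmem n)).2
        _ ≤ C * (‖x₀‖ * C ^ n) := by gcongr
        _ = ‖x₀‖ * C ^ (n + 1) := by ring

/-- Functionals vanishing on the kernel of an operator with closed range factor through it. -/
theorem exists_comp_eq_of_isClosed_range {T : X →L[ℂ] X} (h : IsClosed (Set.range T)) :
    ∃ C > 0, ∀ φ : StrongDual ℂ X, (∀ x, T x = 0 → φ x = 0) →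
      ∃ ψ : StrongDual ℂ X, ψ.comp T = φ ∧ ‖ψ‖ ≤ C * ‖φ‖ := by
  obtain ⟨C, hC, H⟩ := exists_preimage_norm_le_of_isClosed_range h
  refine ⟨C, hC, fun φ hφ ↦ ?_⟩
  choose g hg hgn using fun y : T.range ↦ H y y.2
  have hφ' : ∀ x y, T x = T y → φ x = φ y := fun x y hxy ↦
    sub_eq_zero.1 (by rw [← map_sub]; exact hφ _ (by rw [map_sub, hxy, sub_self]))
  let f : T.range →ₗ[ℂ] ℂ :=
    { toFun := fun y ↦ φ (g y)
      map_add' := fun a b ↦ by rw [← map_add]; exact hφ' _ _ (by simp [hg])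
      map_smul' := fun c a ↦ by
        rw [RingHom.id_apply, ← map_smul]; exact hφ' _ _ (by simp [hg]) }
  have hf : ∀ y, ‖f y‖ ≤ C * ‖φ‖ * ‖y‖ := fun y ↦
    calc ‖φ (g y)‖ ≤ ‖φ‖ * ‖g y‖ := φ.le_opNorm _
      _ ≤ ‖φ‖ * (C * ‖(y : X)‖) := by gcongr; exact hgn y
      _ = C * ‖φ‖ * ‖y‖ := by rw [Submodule.coe_norm]; ring
  obtain ⟨ψ, hψ, hψn⟩ := exists_extension_norm_eq T.range (f.mkContinuous _ hf)
  refine ⟨ψ, ?_, hψn.trans_le (f.mkContinuous_norm_le (by positivity) hf)⟩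
  ext x
  have := hψ ⟨T x, x, rfl⟩
  exact this.trans (hφ' _ _ (hg ⟨T x, x, rfl⟩))

-- Hahn–Banach in the quotient by the closed range.
omit [CompleteSpace X] in
theorem exists_dual_ne_zero_of_range_ne_univ {T : X →L[ℂ] X} (h : IsClosed (Set.range T))
    (hs : ¬ Function.Surjective T) : ∃ φ : StrongDual ℂ X, φ ≠ 0 ∧ φ.comp T = 0 := by
  have hc : IsClosed (T.range : Set X) := by rwa [LinearMap.coe_range]
  obtain ⟨y, hy⟩ := not_forall.1 hs
  have hy' : T.range.mkQL y ≠ 0 := by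
    simpa [Submodule.Quotient.mk_eq_zero] using hy
  obtain ⟨f, hf⟩ := SeparatingDual.exists_ne_zero (R := ℂ) hy'
  refine ⟨f.comp T.range.mkQL, fun h0 ↦ hf (DFunLike.congr_fun h0 y), ?_⟩
  ext x
  have : T.range.mkQL (T x) = 0 := by simp [Submodule.Quotient.mk_eq_zero]
  simp [this]

/-- The invariant is that `φ` annihilates the range of some `T^n`: it then vanishes on the kernel,
so it factors through `T`, and the factor annihilates the range of `T^(n+1)`. -/
theorem IsSemiRegular.exists_dual_backward_orbit {T : X →L[ℂ] X} (h : IsSemiRegular T)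
    {φ₀ : StrongDual ℂ X} (hφ₀ : φ₀.comp T = 0) :
    ∃ (φ : ℕ → StrongDual ℂ X) (C : ℝ), 0 < C ∧ φ 0 = φ₀ ∧ (∀ n, (φ (n + 1)).comp T = φ n) ∧
      ∀ n, ‖φ n‖ ≤ ‖φ₀‖ * C ^ n := by
  obtain ⟨C, hC, H⟩ := exists_comp_eq_of_isClosed_range h.1
  have hker : ∀ φ : StrongDual ℂ X, (∃ n, φ.comp (T ^ n) = 0) → ∀ x, T x = 0 → φ x = 0 := by
    rintro φ ⟨n, hn⟩ x hx
    obtain ⟨u, rfl⟩ := h.2 x hx n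
    exact DFunLike.congr_fun hn u
  have step : ∀ φ : StrongDual ℂ X, (∃ n, φ.comp (T ^ n) = 0) →
      ∃ ψ : StrongDual ℂ X, (ψ.comp T = φ ∧ ‖ψ‖ ≤ C * ‖φ‖) ∧ ∃ n, ψ.comp (T ^ n) = 0 := by
    intro φ hφ
    obtain ⟨ψ, hψ, hn⟩ := H φ (hker φ hφ)
    obtain ⟨n, hn'⟩ := hφ
    refine ⟨ψ, ⟨hψ, hn⟩, n + 1, ?_⟩
    rw [pow_succ', ContinuousLinearMap.mul_def, ← ContinuousLinearMap.comp_assoc, hψ, hn']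
  choose! g hg hgr using step
  have hmem : ∀ n, ∃ m, (g^[n] φ₀).comp (T ^ m) = 0 := by
    intro n
    induction n with
    | zero => exact ⟨1, by simpa using hφ₀⟩
    | succ n ih => rw [Function.iterate_succ_apply']; exact hgr _ ih
  refine ⟨fun n ↦ g^[n] φ₀, C, hC, rfl, fun n ↦ ?_, fun n ↦ ?_⟩
  · simp only [Function.iterate_succ_apply']
    exact (hg _ (hmem n)).1
  · induction n with
    | zero => simp
    | succ n ih =>
      simp only [Function.iterate_succ_apply']
      calc ‖g (g^[n] φ₀)‖ ≤ C * ‖g^[n] φ₀‖ := (hg _ (hmem n)).2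
        _ ≤ C * (‖φ₀‖ * C ^ n) := by gcongr
        _ = ‖φ₀‖ * C ^ (n + 1) := by ring

end SemiRegular

/-! ### Generalized Drazin inverses and decompositions. -/

section GenDrazin

variable {X : Type*} [NormedAddCommGroup X] [NormedSpace ℂ X]

theorem IsSemiRegular.of_bijective {T : X →L[ℂ] X} (h : Function.Bijective T) :
    IsSemiRegular T := by
  refine ⟨by rw [h.2.range_eq]; exact isClosed_univ, fun x hx n ↦ ⟨0, ?_⟩⟩
  rw [map_zero]
  exact (h.1 (by rw [hx, map_zero])).symm

variable [CompleteSpace X]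

omit [CompleteSpace X] in
theorem isUnit_shift_of_isUnit {A B : X →L[ℂ] X} (hc : B * A = A * B) (hB : B ^ 2 * A = B) {z : ℂ}
    (h₁ : IsUnit (shift (A ^ 2 * B - A) (-z))) (h₂ : IsUnit (1 - z • B)) :
    IsUnit (shift A z) := by
  have hB' : A * (B * B) = B := by
    rw [← mul_assoc, ← hc, mul_assoc, ← hc, ← mul_assoc, ← sq, hB]
  -- With `Q = A²B - A`, the cross term `QB` vanishes because `AB² = B`.
  have e₁ : shift A z * (1 - A * B - z • B) = -(shift (A ^ 2 * B - A) (-z) * (1 - z • B)) := by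
    simp only [shift, ← ContinuousLinearMap.one_def, sub_mul, mul_sub, smul_mul_assoc,
      mul_smul_comm, mul_one, one_mul, neg_smul, neg_mul, sq, mul_assoc, smul_sub, smul_neg, hB']
    abel
  have hcz : Commute (shift A z) (1 - A * B - z • B) := by
    have hAB : Commute A B := hc.symm
    have h1 : Commute A (1 - A * B - z • B) :=
      ((Commute.one_right A).sub_right ((Commute.refl A).mul_right hAB)).sub_right
        (hAB.smul_right z)
    exact h1.sub_left ((Commute.one_left _).smul_left z)
  have hu : IsUnit (shift A z * (1 - A * B - z • B)) := by
    rw [e₁, IsUnit.neg_iff]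
    exact h₁.mul h₂
  exact (hcz.isUnit_mul_iff.1 hu).1

theorem eventually_isUnit_one_sub_smul (B : X →L[ℂ] X) :
    ∀ᶠ z : ℂ in 𝓝 0, IsUnit (1 - z • B) := by
  have hcont : Continuous fun z : ℂ ↦ (1 : X →L[ℂ] X) - z • B := by fun_prop
  exact hcont.continuousAt.eventually (Units.isOpen.mem_nhds (by simp))

/-- `0` is at most an isolated spectral point of a generalized Drazin invertible operator. -/
theorem IsGenDrazinInvertible.eventually_bijective {A : X →L[ℂ] X}
    (h : IsGenDrazinInvertible A) : ∀ᶠ z in 𝓝[≠] 0, Function.Bijective (shift A z) := by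
  obtain ⟨B, hc, hB, hq⟩ := h
  filter_upwards [(eventually_isUnit_one_sub_smul B).filter_mono nhdsWithin_le_nhds,
    self_mem_nhdsWithin] with z hz hz0
  rw [← ContinuousLinearMap.isUnit_iff_bijective]
  refine isUnit_shift_of_isUnit hc hB ?_ hz
  exact ContinuousLinearMap.isUnit_iff_bijective.2
    (isQuasinilpotent_iff.1 hq _ (neg_ne_zero.2 hz0))

theorem IsGenDrazinInvertible.isPseudoFredholm {A : X →L[ℂ] X} (h : IsGenDrazinInvertible A) :
    IsPseudoFredholm A := by
  obtain ⟨B, hc, hB, hq⟩ := h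
  have hcx : ∀ x, B (A x) = A (B x) := DFunLike.congr_fun hc
  have hBx : ∀ x, B (A (B x)) = B x := fun x ↦ by
    rw [← hcx]; simpa [sq] using DFunLike.congr_fun hB x
  have hABB : ∀ x, A (B (B x)) = B x := fun x ↦ by rw [← hcx, hBx]
  have hP : IsIdempotentElem (A * B) := by
    ext x
    simp [hBx]
  have hT := ContinuousLinearMap.IsIdempotentElem.isTopCompl hP
  have hM : ∀ x, x ∈ (A * B).range ↔ A (B x) = x := fun x ↦
    ⟨by rintro ⟨y, rfl⟩; simp [hBx], fun hx ↦ ⟨x, hx⟩⟩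
  have hN : ∀ x, x ∈ (A * B).ker ↔ A (B x) = 0 := fun x ↦ Iff.rfl
  have hAM : Set.MapsTo A (A * B).range (A * B).range := fun x hx ↦ by
    rw [SetLike.mem_coe, hM] at hx ⊢
    rw [hcx, hx]
  have hAN : Set.MapsTo A (A * B).ker (A * B).ker := fun x hx ↦ by
    rw [SetLike.mem_coe, hN] at hx ⊢
    rw [hcx, hx, map_zero]
  refine ⟨(A * B).range, (A * B).ker, hAM, hAN, hT.isClosed, hT.isClosed', hT.isCompl, ?_, ?_⟩
  · refine IsSemiRegular.of_bijective ⟨fun x y hxy ↦ Subtype.ext ?_, fun y ↦ ?_⟩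
    · have hxy' : A x = A y := congrArg Subtype.val hxy
      rw [← (hM x).1 x.2, ← (hM y).1 y.2, ← hcx, ← hcx, hxy']
    · refine ⟨⟨B y, (hM _).2 ?_⟩, Subtype.ext ((hM y).1 y.2)⟩
      rw [← hcx, hBx]
  · have := hT.isClosed'.completeSpace_coe
    rw [isQuasinilpotent_iff] at hq ⊢
    intro z hz
    have hbij := hq (-z) (neg_ne_zero.2 hz)
    have hQ : ∀ x, shift (A ^ 2 * B - A) (-z) x = A (A (B x)) - A x + z • x := fun x ↦ by
      simp [shift_apply, sq]
    refine ⟨fun x y hxy ↦ Subtype.ext (hbij.1 ?_), fun y ↦ ?_⟩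
    · have hxy' : A x - z • (x : X) = A y - z • (y : X) := by
        simpa only [coe_shift_restrict] using congrArg Subtype.val hxy
      rw [hQ, hQ, (hN x).1 x.2, (hN y).1 y.2, map_zero]
      linear_combination (norm := module) (-1 : ℂ) • hxy'
    · obtain ⟨x, hx⟩ := hbij.2 (-y)
      rw [hQ] at hx
      -- Applying `AB` to the equation kills `y` and the `Q` part, leaving `z ABx = 0`; the solution
      -- thus stays in the kernel of `AB`, where `Q = -A`.
      have hxN : A (B x) = 0 := by
        refine hbij.1 ?_
        rw [hQ, map_zero, hBx]
        have := congrArg (fun u ↦ A (B u)) hx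
        simpa only [map_add, map_sub, map_smul, map_neg, hcx, hABB, (hN y).1 y.2, neg_zero] using this
      refine ⟨⟨x, hxN⟩, Subtype.ext ?_⟩
      rw [hxN, map_zero] at hx
      rw [coe_shift_restrict]
      linear_combination (norm := module) (-1 : ℂ) • hx

theorem isGenDrazinInvertible_of_isCompl {A : X →L[ℂ] X} {M N : Submodule ℂ X}
    (hM : Set.MapsTo A M M) (hN : Set.MapsTo A N N) (hT : M.IsTopCompl N)
    (hb : Function.Bijective (A.restrict hM)) (hq : IsQuasinilpotent (A.restrict hN)) :
    IsGenDrazinInvertible A := by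
  have := hT.isClosed.completeSpace_coe
  have := hT.isClosed'.completeSpace_coe
  let e := ContinuousLinearEquiv.ofBijective (A.restrict hM)
    (LinearMap.ker_eq_bot.2 hb.1) (LinearMap.range_eq_top.2 hb.2)
  have he : ∀ m : M, A (e.symm m) = m := fun m ↦ congrArg Subtype.val (e.apply_symm_apply m)
  have he' : ∀ m : M, e.symm ⟨A m, hM m.2⟩ = m := fun m ↦ e.symm_apply_apply m
  let B : X →L[ℂ] X := M.subtypeL ∘L (e.symm : M →L[ℂ] M) ∘L M.projectionOntoL N hT
  have hBm : ∀ m : M, B m = e.symm m := fun m ↦ by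
    simp only [B, ContinuousLinearMap.comp_apply, Submodule.projectionOntoL_apply_left]; rfl
  have hBn : ∀ n : N, B n = 0 := fun n ↦ by
    simp only [B, ContinuousLinearMap.comp_apply, Submodule.projectionOntoL_apply_right, map_zero]
  have hAm : ∀ m : M, A m = (⟨A m, hM m.2⟩ : M) := fun _ ↦ rfl
  have hAn : ∀ n : N, A n = (⟨A n, hN n.2⟩ : N) := fun _ ↦ rfl
  have hdec : ∀ x : X, ∃ (m : M) (n : N), x = m + n := fun x ↦ by
    obtain ⟨m, hm, n, hn, h⟩ := Submodule.mem_sup.1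
      (hT.isCompl.sup_eq_top ▸ Submodule.mem_top : x ∈ M ⊔ N)
    exact ⟨⟨m, hm⟩, ⟨n, hn⟩, h.symm⟩
  have hBA : ∀ m : M, B (A m) = m := fun m ↦ by rw [hAm, hBm, he']
  have hBAn : ∀ n : N, B (A n) = 0 := fun n ↦ by rw [hAn, hBn]
  refine ⟨B, ?_, ?_, ?_⟩
  · ext x
    obtain ⟨m, n, rfl⟩ := hdec x
    simp [hBA, hBAn, hBn, hBm, he]
  · ext x
    obtain ⟨m, n, rfl⟩ := hdec x
    simp [sq, hBA, hBAn, hBn]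
  · rw [isQuasinilpotent_iff] at hq ⊢
    intro z hz
    -- `A²B - A` is `0` on `M` and `-A` on `N`.
    have hQ : ∀ (m : M) (n : N), shift (A ^ 2 * B - A) z ((m : X) + n) =
        ((-z • m : M) : X) + ((-(shift (A.restrict hN) (-z) n) : N) : X) := fun m n ↦ by
      rw [shift_apply]
      simp only [sq, sub_apply, mul_apply_eq_comp,
        map_add, hBm, hBn, he, map_zero, Submodule.coe_neg, coe_shift_restrict, Submodule.coe_smul,
        smul_add, neg_smul]
      abel
    have hbij := hq (-z) (neg_ne_zero.2 hz)
    refine ⟨(injective_iff_map_eq_zero _).2 fun x hx ↦ ?_, fun y ↦ ?_⟩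
    · obtain ⟨m, n, rfl⟩ := hdec x
      rw [hQ] at hx
      have h1 := Submodule.disjoint_def.1 hT.isCompl.disjoint _ (-z • m : M).2
        (by rw [eq_neg_of_add_eq_zero_left hx]; exact N.neg_mem (Subtype.prop _))
      rw [h1, zero_add] at hx
      have hm : m = 0 := by simpa [hz] using h1
      have hn : n = 0 := hbij.1 (by
        rw [map_zero]; exact neg_eq_zero.1 (Subtype.ext hx))
      simp [hm, hn]
    · obtain ⟨m, n, rfl⟩ := hdec y
      obtain ⟨n', hn'⟩ := hbij.2 (-n)
      refine ⟨((-z)⁻¹ • m : M) + n', ?_⟩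
      rw [hQ, hn', smul_inv_smul₀ (neg_ne_zero.2 hz), neg_neg]

theorem isGenDrazinInvertible_of_isPseudoFredholm {T : X →L[ℂ] X} {z₀ : ℂ}
    (h : IsPseudoFredholm (shift T z₀)) (h₁ : HasSVEPAt T z₀) (h₂ : HasSVEPAt (dualOp T) z₀) :
    IsGenDrazinInvertible (shift T z₀) := by
  obtain ⟨M, N, hM, hN, hMc, hNc, hMN, hs, hq⟩ := h
  have hT := Submodule.IsCompl.isTopCompl_of_isClosed hMN hMc hNc
  have := hMc.completeSpace_coe
  refine isGenDrazinInvertible_of_isCompl hM hN hT ⟨?_, ?_⟩ hq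
  · refine (injective_iff_map_eq_zero _).2 fun x₀ hx₀ ↦ ?_
    obtain ⟨x, C, hC, rfl, hxs, hxn⟩ := hs.exists_backward_orbit hx₀
    exact Subtype.ext (h₁.eq_zero_of_backward_orbit (x := fun n ↦ (x n : X)) hC hxn
      (congrArg Subtype.val hx₀) fun n ↦ congrArg Subtype.val (hxs n))
  · by_contra hsurj
    obtain ⟨φ₀, hφ₀, hφ₀'⟩ := exists_dual_ne_zero_of_range_ne_univ hs.1 hsurj
    obtain ⟨φ, C, hC, rfl, hφs, hφn⟩ := hs.exists_dual_backward_orbit hφ₀'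
    -- The orbit lives in the dual of `M`; composing with `π`, which intertwines `A` and `A|M`,
    -- carries it to the dual of `X`, where SVEP of `T*` applies.
    set π := M.projectionOntoL N hT with hπ
    have hcomm : π.comp (shift T z₀) = ((shift T z₀).restrict hM).comp π := by
      ext x
      obtain ⟨m, hm, n, hn, rfl⟩ := Submodule.mem_sup.1
        (hMN.sup_eq_top ▸ Submodule.mem_top : x ∈ M ⊔ N)
      have e₁ := Submodule.projectionOntoL_apply_left hT ⟨m, hm⟩
      have e₂ := Submodule.projectionOntoL_apply_right hT ⟨n, hn⟩
      have e₃ := Submodule.projectionOntoL_apply_left hT ⟨_, hM hm⟩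
      have e₄ := Submodule.projectionOntoL_apply_right hT ⟨_, hN hn⟩
      simp only [ContinuousLinearMap.comp_apply, map_add, hπ, e₁, e₂, e₃, e₄, map_zero, add_zero]
      rfl
    refine hφ₀ ?_
    have h0 : (φ 0).comp π = 0 := by
      refine h₂.eq_zero_of_backward_orbit (x := fun n ↦ (φ n).comp π) (K := ‖φ 0‖ * ‖π‖) hC
        (fun n ↦ ?_) ?_ fun n ↦ ?_
      · calc ‖(φ n).comp π‖ ≤ ‖φ n‖ * ‖π‖ := ContinuousLinearMap.opNorm_comp_le _ _
          _ ≤ ‖φ 0‖ * C ^ n * ‖π‖ := by gcongr; exact hφn n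
          _ = ‖φ 0‖ * ‖π‖ * C ^ n := by ring
      · rw [← dualOp_shift, dualOp_apply, ContinuousLinearMap.comp_assoc, hcomm,
          ← ContinuousLinearMap.comp_assoc, hφ₀', ContinuousLinearMap.zero_comp]
      · rw [← dualOp_shift, dualOp_apply, ContinuousLinearMap.comp_assoc, hcomm,
          ← ContinuousLinearMap.comp_assoc, hφs]
    ext m
    simpa [hπ] using DFunLike.congr_fun h0 (m : X)

theorem isGenDrazinInvertible_shift_iff {T : X →L[ℂ] X} {z₀ : ℂ} :
    IsGenDrazinInvertible (shift T z₀) ↔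
      IsPseudoFredholm (shift T z₀) ∧ HasSVEPAt T z₀ ∧ HasSVEPAt (dualOp T) z₀ := by
  refine ⟨fun h ↦ ⟨h.isPseudoFredholm, ?_⟩, fun h ↦
    isGenDrazinInvertible_of_isPseudoFredholm h.1 h.2.1 h.2.2⟩
  have hb : ∀ᶠ z in 𝓝[≠] z₀, Function.Bijective (shift T z) := by
    have ht : Tendsto (fun z ↦ z - z₀) (𝓝[≠] z₀) (𝓝[≠] 0) := by
      refine tendsto_nhdsWithin_iff.2 ⟨?_, ?_⟩
      · have : Continuous fun z : ℂ ↦ z - z₀ := by fun_prop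
        simpa using (this.tendsto z₀).mono_left nhdsWithin_le_nhds
      · filter_upwards [self_mem_nhdsWithin] with z hz using sub_ne_zero.2 hz
    filter_upwards [ht.eventually h.eventually_bijective] with z hz
    rwa [shift_shift, add_sub_cancel] at hz
  refine ⟨hasSVEPAt_of_frequently_injective (hb.mono fun z hz ↦ hz.1).frequently,
    hasSVEPAt_of_frequently_injective (hb.mono fun z hz ↦ ?_).frequently⟩
  refine (injective_iff_map_eq_zero _).2 fun φ hφ ↦ ?_
  rw [← dualOp_shift] at hφ
  ext x
  obtain ⟨y, rfl⟩ := hz.2 x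
  exact DFunLike.congr_fun hφ y

end GenDrazin

end GenKato

theorem mainTheorem1 {X : Type*} [NormedAddCommGroup X] [NormedSpace ℂ X] [CompleteSpace X]
    (T : X →L[ℂ] X) :
    GenKato.genDrazinSpectrum T =
      GenKato.genKatoSpectrum T ∪
        (GenKato.svepFailure T ∪ GenKato.svepFailure (GenKato.dualOp T)) := by
  ext z
  simp only [GenKato.genDrazinSpectrum, GenKato.genKatoSpectrum, GenKato.svepFailure,
    Set.mem_union, Set.mem_ofPred_eq, GenKato.isGenDrazinInvertible_shift_iff]
  tauto
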